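/- For a finite group $G$ and a subgroup $H \le G$ put $m_G(H) = |H|\,|C_G(H)|$, and let $\mathcal{CD}(G)$ be the set of all subgroups $H \le G$ for which $m_G(H)$ is maximal, ordered by inclusion (the Chermak--Delgado lattice of $G$). We say that $\mathcal{CD}(G)$ is a chain of length $n$ if $\mathcal{CD}(G) = \{G_0, \ldots, G_n\}$ for subgroups $G_0 < G_1 < \cdots < G_n$ of $G$. For $A \le G$ and $x \in G$, let $[A,x]$ denote the subgroup generated by all commutators $[a,x]$ with $a \in A$. Let $p$ be a prime and let $P$ be a finite $p$-group of order at most $p^6$. Then $\mathcal{CD}(P)$ is a chain of length $2$ if and only if $p \neq 2$, $|P| = p^6$, $|Z(P)| = p^2$, $|P'| = p^3$, and there exists an abelian normal subgroup $A$ of $P$ with $|A| = p^4$ and $[A,x] = Z(P)$ for all $x \in P \setminus A$. In this case, $\mathcal{CD}(P) = \{Z(P), A, P\}$ for every such subgroup $A$. -/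

import Mathlib

/-- The Chermak-Delgado measure `m_G(H) = |H| |C_G(H)|` of a subgroup `H` of a finite group. -/
noncomputable def cdMeasure {G : Type*} [Group G] (H : Subgroup G) : ℕ :=
  Nat.card H * Nat.card (Subgroup.centralizer (H : Set G))

/-- The Chermak-Delgado lattice of a finite group: the subgroups of maximal measure
(ordered by inclusion, as in `Subgroup G`). -/
def CD (G : Type*) [Group G] : Set (Subgroup G) :=
  {H | ∀ K : Subgroup G, cdMeasure K ≤ cdMeasure H}

/-- A set of subgroups is a chain of length `n` if its members are exactly the terms of a
series `G_0 < ... < G_n`. -/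
def IsChainOfLength {G : Type*} [Group G] (S : Set (Subgroup G)) (n : ℕ) : Prop :=
  ∃ f : Fin (n + 1) → Subgroup G, StrictMono f ∧ Set.range f = S

/-- `[A, x]`, the subgroup generated by the commutators
`[a, x] = a⁻¹ x⁻¹ a x` with `a ∈ A`. -/
def commutatorWith {G : Type*} [Group G] (A : Subgroup G) (x : G) : Subgroup G :=
  Subgroup.closure {g | ∃ a ∈ A, g = a⁻¹ * x⁻¹ * a * x}

/-- `A` is an abelian normal subgroup of order `p ^ 4` such that `[A, x] = Z(G)` for all `x`
outside `A`. -/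
def IsMiddleSubgroup (p : ℕ) {G : Type*} [Group G] (A : Subgroup G) : Prop :=
  A.Normal ∧ IsMulCommutative A ∧ Nat.card A = p ^ 4 ∧
    ∀ x : G, x ∉ A → commutatorWith A x = Subgroup.center G

open Subgroup
open scoped commutatorElement

/-! Taking centralizers reverses the lattice, so a chain H < K < L satisfies C(H) = L, C(K) = K,
C(L) = H and |H||L| = |K|². Write the orders as p^a, p^b, p^c. Then a ≥ 1, because Z(P) ≤ H. If b =
a + 1, or if (a, b, c) = (1, 3, 5), adjoining one element to H gives a further abelian member of the
lattice. With c ≤ 6 this leaves (2, 4, 6), so H = Z(P) and L = P (`isChainMiddle_of_CD_eq`).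

Put A = K. Since no other subgroup has measure at least p^8, C_A(x) = Z(P) for x outside A, and
A/Z(P) is central in P/Z(P). Hence a ↦ [a, x] is a homomorphism from A onto Z(P). If P' ≤ Z(P), then
C(y) for y outside A would be another abelian subgroup of order p^4; so P' is not central. This
yields |P'| = p^3 and excludes p = 2.

Conversely, Z(P), A and P have measure p^8. If neither H nor C(H) lies in A, both meet A inside
Z(P), and measure p^8 forces HA = C(H)A = P. Then P/Z(P) is abelian, against |P'| > |Z(P)|
(`IsMiddleSubgroup.eq_of_le_cdMeasure`). -/

/-! ### Finite p-groups: centralizers, commutators and central quotients -/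

theorem IsPGroup.mul_card_le_of_lt {p : ℕ} [hp : Fact p.Prime] {G : Type*} [Group G] [Finite G]
    (hG : IsPGroup p G) {H K : Subgroup G} (h : H < K) : p * Nat.card H ≤ Nat.card K := by
  obtain ⟨i, hi⟩ := IsPGroup.iff_card.1 (hG.to_subgroup H)
  obtain ⟨j, hj⟩ := IsPGroup.iff_card.1 (hG.to_subgroup K)
  have hlt : Nat.card H < Nat.card K := by
    by_contra! hle
    exact h.ne (eq_of_le_of_card_ge h.le hle)
  rw [hi, hj] at *
  rw [← pow_succ']
  exact Nat.pow_le_pow_right hp.out.pos ((Nat.pow_lt_pow_iff_right hp.out.one_lt).1 hlt)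

theorem Subgroup.lt_sup_zpowers {G : Type*} [Group G] {H : Subgroup G} {x : G} (hx : x ∉ H) :
    H < H ⊔ zpowers x := by
  refine lt_of_le_of_ne le_sup_left fun h => hx ?_
  rw [h]
  exact (le_sup_right : zpowers x ≤ _) (mem_zpowers x)

/-- A nontrivial normal subgroup of a finite `p`-group meets the centre nontrivially. -/
theorem IsPGroup.exists_ne_one_mem_center {p : ℕ} [hp : Fact p.Prime] {G : Type*} [Group G]
    [Finite G] (hG : IsPGroup p G) (M : Subgroup G) [M.Normal] (hM : M ≠ ⊥) :
    ∃ z ∈ M, z ≠ 1 ∧ z ∈ center G := by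
  let _ : MulAction G M := MulAction.compHom M (MulAut.conjNormal : G →* MulAut M)
  have hsmul : ∀ (g : G) (m : M), ((g • m : M) : G) = g * m * g⁻¹ := fun g m =>
    MulAut.conjNormal_apply g m
  have hdvd : p ∣ Nat.card M := by
    rcases (hG.to_subgroup M).card_eq_or_dvd with h | h
    · exact absurd (card_eq_one.1 h) hM
    · exact h
  obtain ⟨b, hb, hne⟩ := hG.exists_fixed_point_of_prime_dvd_card_of_fixed_point M hdvd
    (a := 1) (fun g => by ext; simp [hsmul])
  refine ⟨b, b.2, fun h => hne ?_, mem_center_iff.2 fun g => ?_⟩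
  · ext; simp [h]
  · have := congrArg Subtype.val (hb g)
    rw [hsmul] at this
    exact mul_inv_eq_iff_eq_mul.1 this

theorem QuotientGroup.mk_mul_comm_iff {G : Type*} [Group G] (N : Subgroup G) [N.Normal]
    (x y : G) : (x : G ⧸ N) * y = y * x ↔ ⁅x, y⁆ ∈ N := by
  rw [← commutatorElement_eq_one_iff_mul_comm, ← QuotientGroup.eq_one_iff]
  rfl

theorem IsPGroup.exists_mem_notMem_commutator_mem {p : ℕ} [hp : Fact p.Prime] {G : Type*}
    [Group G] [Finite G] (hG : IsPGroup p G) {N M : Subgroup G} [N.Normal] [M.Normal]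
    (h : N < M) : ∃ z ∈ M, z ∉ N ∧ ∀ g : G, ⁅g, z⁆ ∈ N := by
  have hnorm : (M.map (QuotientGroup.mk' N)).Normal :=
    Normal.map inferInstance _ (QuotientGroup.mk'_surjective N)
  obtain ⟨_, ⟨z, hz, rfl⟩, h1, hc⟩ := (hG.to_quotient N).exists_ne_one_mem_center
    (M.map (QuotientGroup.mk' N)) (by
      rw [Ne, Subgroup.map_eq_bot_iff, QuotientGroup.ker_mk']
      exact h.not_ge)
  refine ⟨z, hz, fun hzN => h1 ((QuotientGroup.eq_one_iff z).2 hzN), fun g => ?_⟩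
  exact (QuotientGroup.mk_mul_comm_iff N g z).1 (mem_center_iff.1 hc g)

/-- The orbit of `z` under conjugation by `S` has `|S : C_S(z)|` elements. -/
theorem Subgroup.card_le_ncard_mul_card_inf_centralizer {G : Type*} [Group G] [Finite G]
    (S : Subgroup G) (z : G) (X : Set G) (hX : ∀ g ∈ S, g * z * g⁻¹ ∈ X) :
    Nat.card S ≤ X.ncard * Nat.card (S ⊓ centralizer {z} : Subgroup G) := by
  have hle : S ⊓ centralizer {z} ≤ S := inf_le_left
  rw [← ((S ⊓ centralizer {z}).subgroupOf S).card_mul_index, mul_comm,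
    Nat.card_congr (subgroupOfEquivOfLe hle).toEquiv, ← Nat.card_coe_set_eq]
  refine Nat.mul_le_mul_right _ (Nat.card_le_card_of_injective
    (fun q : S ⧸ (S ⊓ centralizer {z}).subgroupOf S =>
      (⟨q.out * z * (q.out : G)⁻¹, hX _ q.out.2⟩ : X)) fun q r hqr => ?_)
  rw [← Quotient.out_eq' q, ← Quotient.out_eq' r]
  refine QuotientGroup.eq.2 ?_
  rw [mem_subgroupOf, mem_inf, mem_centralizer_singleton_iff]
  refine ⟨SetLike.coe_mem _, ?_⟩
  have h : (q.out : G) * z * (q.out : G)⁻¹ = r.out * z * (r.out : G)⁻¹ :=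
    congrArg Subtype.val hqr
  have h2 : z * (q.out : G)⁻¹ * r.out = (q.out : G)⁻¹ * r.out * z := by
    calc z * (q.out : G)⁻¹ * r.out
        = (q.out : G)⁻¹ * ((q.out : G) * z * (q.out : G)⁻¹) * r.out := by group
      _ = _ := by rw [h]; group
  push_cast
  simpa [mul_assoc] using h2.symm

/-- Since gzg⁻¹ = ⁅g, z⁆z, the conjugates of z under S lie in the coset Nz. -/
theorem Subgroup.card_le_card_mul_card_inf_centralizer {G : Type*} [Group G] [Finite G]
    (S N : Subgroup G) (z : G) (h : ∀ g ∈ S, ⁅g, z⁆ ∈ N) :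
    Nat.card S ≤ Nat.card N * Nat.card (S ⊓ centralizer {z} : Subgroup G) := by
  have := S.card_le_ncard_mul_card_inf_centralizer z ((· * z) '' (N : Set G)) fun g hg =>
    ⟨_, h g hg, by simp [commutatorElement_def]⟩
  rwa [Set.ncard_image_of_injective _ (mul_left_injective z), ← Nat.card_coe_set_eq] at this

theorem mem_commutatorWith_of_mem {G : Type*} [Group G] {A : Subgroup G} {a : G} (ha : a ∈ A)
    (x : G) : a⁻¹ * x⁻¹ * a * x ∈ commutatorWith A x :=
  subset_closure ⟨a, ha, rfl⟩

/-- If `a ↦ [a, x]` is a homomorphism on `A`, its kernel is `C_A(x)` and its image `[A, x]`. -/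
theorem card_commutatorWith_mul_card {G : Type*} [Group G] [Finite G] (A : Subgroup G) (x : G)
    (h : ∀ a ∈ A, ∀ b ∈ A, (a⁻¹ * x⁻¹ * a * x) * b = b * (a⁻¹ * x⁻¹ * a * x)) :
    Nat.card (commutatorWith A x) * Nat.card (A ⊓ centralizer {x} : Subgroup G) =
      Nat.card A := by
  let φ : A →* G := MonoidHom.mk' (fun a => (a : G)⁻¹ * x⁻¹ * a * x) fun a b => by
    have := h a a.2 b b.2
    calc ((a * b : A) : G)⁻¹ * x⁻¹ * (a * b : A) * x
        = (b : G)⁻¹ * (((a : G)⁻¹ * x⁻¹ * a * x) * b) * (b : G)⁻¹ * x⁻¹ * b * x := by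
          push_cast; group
      _ = _ := by rw [this]; group
  have hr : φ.range = commutatorWith A x := by
    apply le_antisymm
    · rintro _ ⟨a, rfl⟩
      exact mem_commutatorWith_of_mem a.2 x
    · rw [commutatorWith, closure_le]
      rintro _ ⟨a, ha, rfl⟩
      exact ⟨⟨a, ha⟩, rfl⟩
  have hk : φ.ker = (A ⊓ centralizer {x}).subgroupOf A := by
    ext a
    rw [MonoidHom.mem_ker, mem_subgroupOf, mem_inf, mem_centralizer_singleton_iff]
    change (a : G)⁻¹ * x⁻¹ * a * x = 1 ↔ _
    rw [and_iff_right a.2, show (a : G)⁻¹ * x⁻¹ * a * x = (x * a)⁻¹ * (a * x) by group,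
      inv_mul_eq_one, eq_comm]
  rw [← hr, ← φ.ker.card_mul_index, index_ker, mul_comm, hk, Nat.card_congr (subgroupOfEquivOfLe
    (inf_le_left : A ⊓ centralizer {x} ≤ A)).toEquiv]

/-- A `p`-group with a central subgroup of index at most `p` is commutative. -/
theorem IsPGroup.mul_comm_of_card_le {p : ℕ} [hp : Fact p.Prime] {G : Type*}
    [Group G] [Finite G] (hG : IsPGroup p G) (K : Subgroup G) (hK : K ≤ center G)
    (h : Nat.card G ≤ p * Nat.card K) (a b : G) : a * b = b * a := by
  obtain ⟨n, hn⟩ := hG.index (center G)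
  have hle : (center G).index ≤ p := by
    have h1 := (center G).card_mul_index
    have h2 := card_le_of_le hK
    have h3 : 0 < Nat.card (center G) := Nat.card_pos
    by_contra! hlt
    nlinarith
  have hdvd : Nat.card (G ⧸ center G) ∣ p := by
    change (center G).index ∣ p
    rw [hn] at hle ⊢
    have : n ≤ 1 := by
      by_contra! h2
      exact absurd hle (not_le.2 (by simpa using Nat.pow_lt_pow_right hp.out.one_lt h2))
    simpa using pow_dvd_pow p this
  have := isCyclic_of_card_dvd_prime hdvd
  exact ((QuotientGroup.mk' (center G)).isMulCommutative_of_isCyclic_of_ker_le_center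
    (by rw [QuotientGroup.ker_mk'])).is_comm.comm a b

theorem Subgroup.card_map_mk'_mul_card {G : Type*} [Group G] [Finite G] (N H : Subgroup G)
    [N.Normal] (h : N ≤ H) :
    Nat.card (H.map (QuotientGroup.mk' N)) * Nat.card N = Nat.card H := by
  have h1 := H.card_mul_index
  have h2 := N.card_mul_index
  have h3 := (H.map (QuotientGroup.mk' N)).card_mul_index
  rw [index_map_eq _ (QuotientGroup.mk'_surjective N) (by rwa [QuotientGroup.ker_mk'])] at h3
  have h4 : Nat.card (G ⧸ N) = N.index := rfl
  have h5 : 0 < H.index := Nat.pos_of_ne_zero H.index_ne_zero_of_finite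
  rw [h4] at h3
  refine Nat.eq_of_mul_eq_mul_right h5 ?_
  rw [h1, ← h2, ← h3]
  ring

theorem Subgroup.normal_of_le_center {G : Type*} [Group G] {H : Subgroup G}
    (h : H ≤ center G) : H.Normal :=
  ⟨fun n hn g => by rwa [mem_center_iff.1 (h hn) g, mul_inv_cancel_right]⟩

/-- An element outside a normal subgroup `B` of order `p ^ 2` centralizing it. -/
theorem IsPGroup.exists_notMem_centralizing {p : ℕ} [hp : Fact p.Prime] {Q : Type*} [Group Q]
    [Finite Q] (hQ : IsPGroup p Q) (hcard : Nat.card Q = p ^ 4) (B : Subgroup Q) [B.Normal]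
    (hB : Nat.card B = p ^ 2) :
    ∃ m, m ∉ B ∧ ∀ b ∈ B, m * b = b * m := by
  have h1 := hp.out.one_lt
  by_cases hcen : B ≤ center Q
  · have hlt : B < ⊤ := lt_top_iff_ne_top.2 fun h => by
      rw [h, card_top, hcard] at hB
      exact absurd (Nat.pow_right_injective h1 hB) (by norm_num)
    obtain ⟨m, -, hm⟩ := SetLike.exists_of_lt hlt
    exact ⟨m, hm, fun b hb => mem_center_iff.1 (hcen hb) m⟩
  · obtain ⟨b, hb, hbc⟩ := SetLike.not_le_iff_exists.1 hcen
    -- The orbit of b avoids 1, so it has at most p² - 1 elements; hence |C(b)| > p² and C(b) is not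
    -- inside B.
    have hle := (⊤ : Subgroup Q).card_le_ncard_mul_card_inf_centralizer b ((B : Set Q) \ {1})
      fun g _ => ⟨Normal.conj_mem inferInstance b hb g, by
        rw [Set.mem_singleton_iff, conj_eq_one_iff]
        rintro rfl
        exact hbc (one_mem _)⟩
    have hn : ((B : Set Q) \ {1}).ncard + 1 = p ^ 2 := by
      rw [Set.ncard_sdiff_singleton_add_one (one_mem B) (Set.toFinite _), ← hB]
      exact (Nat.card_coe_set_eq _).symm
    rw [top_inf_eq, card_top, hcard] at hle
    have hnle : ¬ centralizer {b} ≤ B := fun h => by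
      have := card_le_of_le h
      rw [hB] at this
      have h0 : 0 < p ^ 2 := by positivity
      nlinarith
    obtain ⟨m, hm, hmB⟩ := SetLike.not_le_iff_exists.1 hnle
    refine ⟨m, hmB, fun c hc => ?_⟩
    -- C_B(m) contains the nontrivial group Z(Q) ∩ B and also the noncentral b, so its order is at
    -- least p² = |B|.
    have hbot : ⊥ < center Q ⊓ B := by
      obtain ⟨z, hzB, hz1, hz⟩ := hQ.exists_ne_one_mem_center B (fun h => by
        rw [h, card_bot] at hB
        nlinarith)
      exact bot_lt_iff_ne_bot.2 fun h => hz1 (mem_bot.1 (h ▸ mem_inf.2 ⟨hz, hzB⟩))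
    have hlt : center Q ⊓ B < centralizer {m} ⊓ B := by
      refine lt_of_le_of_ne (inf_le_inf_right _ (center_le_centralizer _)) fun h => hbc ?_
      have : b ∈ centralizer {m} ⊓ B :=
        ⟨mem_centralizer_singleton_iff.2 (mem_centralizer_singleton_iff.1 hm).symm, hb⟩
      rw [← h] at this
      exact this.1
    have e1 := hQ.mul_card_le_of_lt hbot
    have e2 := hQ.mul_card_le_of_lt hlt
    have heq : centralizer {m} ⊓ B = B := eq_of_le_of_card_ge inf_le_right (by
      rw [hB]
      rw [card_bot] at e1
      nlinarith)
    rw [← heq] at hc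
    exact (mem_centralizer_singleton_iff.1 hc.1).symm

/-- A `p`-group with a central subgroup of index `p ^ 2` has derived subgroup of order at
most `p`. -/
theorem IsPGroup.card_commutator_le {p : ℕ} [hp : Fact p.Prime] {Q : Type*} [Group Q]
    [Finite Q] (hQ : IsPGroup p Q) (B : Subgroup Q) (hB : B ≤ center Q)
    (hcard : Nat.card Q = p ^ 2 * Nat.card B) : Nat.card (commutator Q) ≤ p := by
  have h1 := hp.out.one_lt
  have hBpos : 0 < Nat.card B := Nat.card_pos
  have : B.Normal := normal_of_le_center hB
  have hcomm : ∀ x y : Q, ⁅x, y⁆ ∈ center Q := fun x y => hB <| by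
    rw [← QuotientGroup.mk_mul_comm_iff]
    refine (IsPGroup.isMulCommutative_of_card_eq_prime_sq (p := p) ?_).is_comm.comm _ _
    refine Nat.eq_of_mul_eq_mul_right hBpos ?_
    rw [← hcard, ← card_eq_card_quotient_mul_card_subgroup]
  obtain ⟨x, -, hx⟩ : ∃ x ∈ (⊤ : Subgroup Q), x ∉ B := SetLike.exists_of_lt <|
    lt_top_iff_ne_top.2 fun h => by
      rw [h, card_top] at hcard hBpos
      have := Nat.one_lt_pow two_ne_zero h1
      nlinarith
  have hBx := hQ.mul_card_le_of_lt (lt_sup_zpowers hx)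
  have hD : ∀ a, a⁻¹ * x⁻¹ * a * x ∈ center Q := fun a => by
    have := hcomm a⁻¹ x⁻¹
    rwa [commutatorElement_def, inv_inv, inv_inv] at this
  have hmul := card_commutatorWith_mul_card (⊤ : Subgroup Q) x
    fun a _ b _ => (mem_center_iff.1 (hD a) b).symm
  set D := commutatorWith (⊤ : Subgroup Q) x with hDdef
  have hDc : D ≤ center Q := by
    rw [hDdef, commutatorWith, closure_le]
    rintro _ ⟨a, -, rfl⟩
    exact hD a
  have hDn : D.Normal := normal_of_le_center hDc
  rw [top_inf_eq, card_top] at hmul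
  -- |D| is the index of C(x), which contains B⟨x⟩, a subgroup of index at most p.
  have hle : Nat.card D ≤ p := by
    have hsub : B ⊔ zpowers x ≤ centralizer {x} := sup_le (hB.trans (center_le_centralizer _))
      (by rw [zpowers_le, mem_centralizer_singleton_iff])
    have h2 := card_le_of_le hsub
    by_contra! hlt
    have : p * (p * Nat.card B) < Nat.card D * Nat.card (centralizer {x} : Subgroup Q) :=
      Nat.mul_lt_mul_of_lt_of_le hlt (hBx.trans h2) Nat.card_pos
    rw [hmul, hcard] at this
    nlinarith
  refine (card_le_of_le ?_).trans hle
  rw [_root_.commutator_def, commutator_le]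
  intro a _ b _
  rw [← QuotientGroup.mk_mul_comm_iff]
  -- Modulo D both B and x become central, and together they have index at most p; so Q/D is
  -- abelian.
  refine (hQ.to_quotient D).mul_comm_of_card_le
    ((D ⊔ (B ⊔ zpowers x)).map (QuotientGroup.mk' D)) ?_ ?_ _ _
  · rw [Subgroup.map_le_iff_le_comap, sup_le_iff, sup_le_iff, zpowers_le]
    refine ⟨?_, ?_, ?_⟩
    · intro d hd
      rw [mem_comap, QuotientGroup.mk'_apply, (QuotientGroup.eq_one_iff d).2 hd]
      exact one_mem _
    · intro d hd
      refine mem_center_iff.2 fun q => ?_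
      obtain ⟨q, rfl⟩ := QuotientGroup.mk_surjective q
      rw [QuotientGroup.mk'_apply, ← QuotientGroup.mk_mul, mem_center_iff.1 (hB hd) q]
      rfl
    · refine mem_center_iff.2 fun q => ?_
      obtain ⟨q, rfl⟩ := QuotientGroup.mk_surjective q
      refine (QuotientGroup.mk_mul_comm_iff D q x).2 ?_
      have := hDn.conj_mem _ (inv_mem (mem_commutatorWith_of_mem (mem_top q⁻¹) x)) x
      convert this using 1
      rw [commutatorElement_def]
      group
  · have h3 := card_map_mk'_mul_card D (D ⊔ (B ⊔ zpowers x)) le_sup_left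
    have h4 := card_eq_card_quotient_mul_card_subgroup D
    have h5 := card_le_of_le (le_sup_right : B ⊔ zpowers x ≤ D ⊔ (B ⊔ zpowers x))
    have hDpos : 0 < Nat.card D := Nat.card_pos
    refine Nat.le_of_mul_le_mul_right ?_ hDpos
    rw [← h4, mul_assoc, h3, hcard]
    nlinarith

/-- Either Q/B is cyclic and B is central, or every element outside B squares to 1 and the usual
argument for exponent 2 applies. This is what rules out p = 2. -/
theorem IsPGroup.comm_of_index_eq_four {Q : Type*} [Group Q] [Finite Q]
    (B : Subgroup Q) (hB : B ≤ center Q) (hcard : Nat.card Q = 4 * Nat.card B)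
    (hsq : ∀ x, x ∉ B → x ^ 2 ∈ B → x ^ 2 = 1) (a b : Q) : a * b = b * a := by
  have : B.Normal := normal_of_le_center hB
  have hq : Nat.card (Q ⧸ B) = 4 := by
    have hBpos : 0 < Nat.card B := Nat.card_pos
    refine Nat.eq_of_mul_eq_mul_right hBpos ?_
    rw [← hcard, ← card_eq_card_quotient_mul_card_subgroup]
  by_cases hex : ∀ x : Q, x ^ 2 ∈ B
  · have key : ∀ x, x ∉ B → x * x = 1 := fun x hx => by
      rw [← sq]; exact hsq x hx (hex x)
    by_cases ha : a ∈ B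
    · exact (mem_center_iff.1 (hB ha) b).symm
    by_cases hb : b ∈ B
    · exact mem_center_iff.1 (hB hb) a
    by_cases hab : a * b ∈ B
    · have := mem_center_iff.1 (hB hab) a
      rw [mul_assoc] at this
      exact mul_left_cancel this
    · have h1 := key a ha
      have h2 := key b hb
      have h3 := key _ hab
      calc a * b = a * (a * b * (a * b)) * b := by rw [h3, mul_one]
        _ = (a * a) * (b * a) * (b * b) := by group
        _ = b * a := by rw [h1, h2, one_mul, mul_one]
  · push Not at hex
    obtain ⟨x, hx⟩ := hex
    have hord : orderOf (x : Q ⧸ B) = 2 ^ (1 + 1) := by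
      apply orderOf_eq_prime_pow
      · rw [pow_one, ← QuotientGroup.mk_pow, QuotientGroup.eq_one_iff]
        exact hx
      · have := pow_card_eq_one' (x := (x : Q ⧸ B))
        rwa [hq] at this
    have := isCyclic_of_orderOf_eq_card (x : Q ⧸ B) (hord.trans hq.symm)
    exact ((QuotientGroup.mk' B).isMulCommutative_of_isCyclic_of_ker_le_center
      (by rwa [QuotientGroup.ker_mk'])).is_comm.comm a b

/-! ### The Chermak–Delgado measure and centralizers -/

theorem cdMeasure_le_centralizer {G : Type*} [Group G] [Finite G] (H : Subgroup G) :
    cdMeasure H ≤ cdMeasure (centralizer (H : Set G)) := by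
  rw [cdMeasure, cdMeasure, mul_comm]
  exact Nat.mul_le_mul_left _ (card_le_of_le (le_centralizer_iff.1 le_rfl))

theorem centralizer_mem_CD {G : Type*} [Group G] [Finite G] {H : Subgroup G} (h : H ∈ CD G) :
    centralizer (H : Set G) ∈ CD G :=
  fun K => (h K).trans (cdMeasure_le_centralizer H)

/-- H ≤ C(C(H)) always holds, and maximality of the measure of H forces the orders to agree. -/
theorem centralizer_centralizer_of_mem_CD {G : Type*} [Group G] [Finite G] {H : Subgroup G}
    (h : H ∈ CD G) : centralizer ((centralizer (H : Set G) : Subgroup G) : Set G) = H := by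
  have h1 := h (centralizer (H : Set G))
  rw [cdMeasure, cdMeasure, mul_comm (Nat.card H)] at h1
  exact (eq_of_le_of_card_ge (le_centralizer_iff.1 le_rfl)
    (Nat.le_of_mul_le_mul_left h1 Nat.card_pos)).symm

theorem cdMeasure_map_conj {G : Type*} [Group G] (H : Subgroup G) (e : G ≃* G) :
    cdMeasure (H.map (e : G →* G)) = cdMeasure H := by
  have h : centralizer ((H.map (e : G →* G) : Subgroup G) : Set G) =
      (centralizer (H : Set G)).map (e : G →* G) := by
    ext x
    rw [mem_centralizer_iff]
    constructor
    · intro hx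
      refine ⟨e.symm x, mem_centralizer_iff.2 fun h hh => e.injective ?_, by simp⟩
      simpa using hx (e h) ⟨h, hh, rfl⟩
    · rintro ⟨y, hy, rfl⟩ _ ⟨h, hh, rfl⟩
      simpa using congrArg e (mem_centralizer_iff.1 hy h hh)
  rw [cdMeasure, cdMeasure, h, card_map_of_injective (f := (e : G →* G)) e.injective,
    card_map_of_injective (f := (e : G →* G)) e.injective]

theorem normal_of_mem_CD_of_card {G : Type*} [Group G] [Finite G] {H : Subgroup G}
    (h : H ∈ CD G) (huniq : ∀ K ∈ CD G, Nat.card K = Nat.card H → K = H) : H.Normal := by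
  refine ⟨fun n hn g => ?_⟩
  have hK := huniq (H.map (MulAut.conj g : G ≃* G)) (fun K => (h K).trans
    (cdMeasure_map_conj H (MulAut.conj g)).ge)
    (card_map_of_injective (MulAut.conj g).injective)
  rw [← hK]
  exact ⟨n, hn, rfl⟩

theorem centralizer_sup_zpowers {G : Type*} [Group G] (H : Subgroup G) (x : G) :
    centralizer ((H ⊔ zpowers x : Subgroup G) : Set G) =
      centralizer (H : Set G) ⊓ centralizer {x} := by
  have hz : centralizer ((zpowers x : Subgroup G) : Set G) = centralizer {x} := by
    rw [zpowers_eq_closure, centralizer_closure]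
  refine le_antisymm (le_inf (centralizer_le fun y hy => mem_sup_left hy) ?_) ?_
  · rw [← hz]
    exact centralizer_le fun y hy => mem_sup_right hy
  · rw [le_centralizer_iff, sup_le_iff, le_centralizer_iff, zpowers_le, mem_centralizer_iff]
    exact ⟨inf_le_left, fun y hy => (mem_centralizer_singleton_iff.1 hy.2)⟩

/-- Inserting into a term of the Chermak-Delgado lattice an element of its centralizer. -/
theorem isMulCommutative_sup_zpowers {G : Type*} [Group G] (H : Subgroup G)
    (hH : H ≤ centralizer (H : Set G)) {x : G} (hx : x ∈ centralizer (H : Set G)) :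
    H ⊔ zpowers x ≤ centralizer ((H ⊔ zpowers x : Subgroup G) : Set G) := by
  rw [centralizer_sup_zpowers]
  refine sup_le (le_inf hH ?_) ?_
  · intro h hh
    exact mem_centralizer_singleton_iff.2 (mem_centralizer_iff.1 hx h hh)
  · rw [zpowers_le]
    exact ⟨hx, mem_centralizer_singleton_iff.2 rfl⟩

/-! ### From a middle subgroup to the lattice -/

theorem IsMiddleSubgroup.exists_notMem {p : ℕ} [hp : Fact p.Prime] {P : Type*} [Group P]
    {A : Subgroup P} (hA : IsMiddleSubgroup p A)
    (hcard : Nat.card P = p ^ 6) : ∃ x, x ∉ A := by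
  by_contra! h
  have : A = ⊤ := eq_top_iff.2 fun x _ => h x
  have h4 := hA.2.2.1
  rw [this, card_top, hcard] at h4
  exact absurd (Nat.pow_right_injective hp.out.one_lt h4) (by norm_num)

theorem IsMiddleSubgroup.mul_eq_mul_swap {p : ℕ} {P : Type*} [Group P] {A : Subgroup P}
    (hA : IsMiddleSubgroup p A) {a b : P}
    (ha : a ∈ A) (hb : b ∈ A) : a * b = b * a :=
  congrArg Subtype.val (hA.2.1.is_comm.comm ⟨a, ha⟩ ⟨b, hb⟩)

theorem commutatorWith_le {P : Type*} [Group P] {A : Subgroup P} [A.Normal] (x : P) : commutatorWith A x ≤ A := by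
  rw [commutatorWith, closure_le]
  rintro _ ⟨a, ha, rfl⟩
  have h := mul_mem (inv_mem ha) (Normal.conj_mem inferInstance a ha x⁻¹)
  rw [inv_inv] at h
  simpa [mul_assoc] using h

section Middle

set_option linter.unusedSectionVars false

variable {p : ℕ} [hp : Fact p.Prime] {P : Type*} [Group P] [Finite P]

theorem IsMiddleSubgroup.center_le {A : Subgroup P} (hA : IsMiddleSubgroup p A)
    (hcard : Nat.card P = p ^ 6) : center P ≤ A := by
  obtain ⟨x, hx⟩ := hA.exists_notMem hcard
  have := hA.1
  rw [← hA.2.2.2 x hx]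
  exact commutatorWith_le x

/-- This is the kernel of a ↦ [a, x] on A, whose image Z(P) has order p²; so the kernel has order p²
too, and it contains Z(P). -/
theorem IsMiddleSubgroup.inf_centralizer {A : Subgroup P} (hA : IsMiddleSubgroup p A)
    (hcard : Nat.card P = p ^ 6) (hZ : Nat.card (center P) = p ^ 2) {x : P} (hx : x ∉ A) :
    A ⊓ centralizer {x} = center P := by
  have := hA.1
  have h := card_commutatorWith_mul_card A x fun a ha b hb =>
    hA.mul_eq_mul_swap (commutatorWith_le x (mem_commutatorWith_of_mem ha x)) hb
  rw [hA.2.2.2 x hx, hZ, hA.2.2.1] at h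
  refine (eq_of_le_of_card_ge (le_inf (hA.center_le hcard) (center_le_centralizer _)) ?_).symm
  rw [hZ]
  have : 0 < p ^ 2 := pow_pos hp.out.pos 2
  refine Nat.le_of_mul_le_mul_left ?_ this
  rw [h, ← pow_add]

/-- Elements of `A` are central modulo the centre. -/
theorem IsMiddleSubgroup.commutator_mem {A : Subgroup P} (hA : IsMiddleSubgroup p A)
    {a : P} (ha : a ∈ A) (x : P) : ⁅a, x⁆ ∈ center P := by
  by_cases hx : x ∈ A
  · rw [commutatorElement_eq_one_iff_mul_comm.2 (hA.mul_eq_mul_swap ha hx)]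
    exact one_mem _
  -- The two commutator conventions differ by inverting both entries, hence x⁻¹.
  · rw [← hA.2.2.2 x⁻¹ (by simpa using hx), commutatorElement_def]
    have := mem_commutatorWith_of_mem (inv_mem ha) x⁻¹
    rwa [inv_inv, inv_inv] at this

theorem IsMiddleSubgroup.centralizer_eq {A : Subgroup P} (hA : IsMiddleSubgroup p A)
    (hcard : Nat.card P = p ^ 6) (hZ : Nat.card (center P) = p ^ 2) {H : Subgroup P}
    (hHA : H ≤ A) (hHZ : ¬ H ≤ center P) : centralizer (H : Set P) = A := by
  refine le_antisymm (fun x hx => ?_) fun a ha => mem_centralizer_iff.2 fun h hh =>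
    hA.mul_eq_mul_swap (hHA hh) ha
  by_contra hxA
  refine hHZ fun h hh => ?_
  rw [← hA.inf_centralizer hcard hZ hxA]
  exact ⟨hHA hh, mem_centralizer_singleton_iff.2 (mem_centralizer_iff.1 hx h hh)⟩

theorem IsMiddleSubgroup.eq_of_le_cdMeasure_of_le {A : Subgroup P} (hA : IsMiddleSubgroup p A)
    (hcard : Nat.card P = p ^ 6) (hZ : Nat.card (center P) = p ^ 2) {H : Subgroup P}
    (hH : p ^ 8 ≤ cdMeasure H) (hHA : H ≤ A) : H = center P ∨ H = A := by
  by_cases hHZ : H ≤ center P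
  · left
    refine eq_of_le_of_card_ge hHZ ?_
    rw [cdMeasure, centralizer_eq_top_iff_subset.2 hHZ, card_top, hcard] at hH
    rw [hZ]
    exact Nat.le_of_mul_le_mul_right (hH.trans_eq' (by ring)) (pow_pos hp.out.pos 6)
  · right
    refine eq_of_le_of_card_ge hHA ?_
    rw [cdMeasure, hA.centralizer_eq hcard hZ hHA hHZ, hA.2.2.1] at hH
    rw [hA.2.2.1]
    exact Nat.le_of_mul_le_mul_right (hH.trans_eq' (by ring)) (pow_pos hp.out.pos 4)

/-- |H| = |HA : A||H ∩ A|, and both factors are at most p². -/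
theorem IsMiddleSubgroup.card_le_of_inf_le {A : Subgroup P} (hA : IsMiddleSubgroup p A)
    (hcard : Nat.card P = p ^ 6) (hZ : Nat.card (center P) = p ^ 2) {H : Subgroup P}
    (hHA : H ⊓ A ≤ center P) : Nat.card H ≤ p ^ 4 ∧ (p ^ 4 ≤ Nat.card H → H ⊔ A = ⊤) := by
  have := hA.1
  have h1 : Nat.card H = A.relIndex H * Nat.card (H ⊓ A : Subgroup P) := by
    have := (A.subgroupOf H).card_mul_index
    rw [← inf_subgroupOf_left, Nat.card_congr (subgroupOfEquivOfLe
      (inf_le_left : H ⊓ A ≤ H)).toEquiv, mul_comm] at this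
    rw [← this, inf_subgroupOf_left]; rfl
  have h2 := card_le_of_le hHA
  rw [hZ] at h2
  have h3 : A.index = p ^ 2 := by
    have := A.card_mul_index
    rw [hA.2.2.1, hcard] at this
    exact Nat.eq_of_mul_eq_mul_left (pow_pos hp.out.pos 4) (this.trans (by ring))
  have h4 : A.relIndex H * (H ⊔ A).index = p ^ 2 := by
    rw [← h3, ← relIndex_sup_right, sup_comm, relIndex_mul_index le_sup_left]
  have hpos : 0 < p ^ 2 := pow_pos hp.out.pos 2
  have h5 : A.relIndex H ≤ p ^ 2 := Nat.le_of_dvd hpos (Dvd.intro _ h4)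
  constructor
  · calc Nat.card H ≤ p ^ 2 * p ^ 2 := h1 ▸ Nat.mul_le_mul h5 h2
      _ = p ^ 4 := by ring
  · intro h6
    have h7 : A.relIndex H = p ^ 2 := by
      refine le_antisymm h5 (Nat.le_of_mul_le_mul_right ?_ hpos)
      calc p ^ 2 * p ^ 2 = p ^ 4 := by ring
        _ ≤ _ := h6
        _ ≤ _ := h1 ▸ Nat.mul_le_mul_left _ h2
    rw [h7] at h4
    rw [← index_eq_one]
    exact Nat.eq_of_mul_eq_mul_left hpos (by rw [h4, mul_one])

/-- Modulo Z(P), A is central, so any two elements may be replaced by one from H and one from C(H),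
which commute. -/
theorem IsMiddleSubgroup.commutator_mem_center_of_sup {A H : Subgroup P}
    (hA : IsMiddleSubgroup p A) (hH : H ⊔ A = ⊤) (hK : centralizer (H : Set P) ⊔ A = ⊤) :
    commutator P ≤ center P := by
  have := hA.1
  rw [_root_.commutator_def, commutator_le]
  intro x _ y _
  obtain ⟨h, hh, a, ha, rfl⟩ := mem_sup_of_normal_right.1 (hH ▸ mem_top x)
  obtain ⟨k, hk, b, hb, rfl⟩ := mem_sup_of_normal_right.1 (hK ▸ mem_top y)
  have hcen : ∀ a ∈ A, ∀ q : P ⧸ center P, (a : P ⧸ center P) * q = q * a := by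
    intro a ha q
    obtain ⟨q, rfl⟩ := QuotientGroup.mk_surjective q
    exact (QuotientGroup.mk_mul_comm_iff _ _ _).2 (hA.commutator_mem ha q)
  have hhk : (h : P ⧸ center P) * k = k * h := by
    rw [← QuotientGroup.mk_mul, mem_centralizer_iff.1 hk h hh]; rfl
  rw [← QuotientGroup.mk_mul_comm_iff, QuotientGroup.mk_mul, QuotientGroup.mk_mul]
  have hx : Commute (h : P ⧸ center P) (k * b) :=
    Commute.mul_right hhk (hcen b hb h).symm
  exact Commute.mul_left hx (hcen a ha _)

theorem IsMiddleSubgroup.eq_of_le_cdMeasure {A : Subgroup P} (hA : IsMiddleSubgroup p A)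
    (hcard : Nat.card P = p ^ 6) (hZ : Nat.card (center P) = p ^ 2)
    (hder : ¬ commutator P ≤ center P) {H : Subgroup P}
    (hH : p ^ 8 ≤ cdMeasure H) : H = center P ∨ H = A ∨ H = ⊤ := by
  by_cases hHA : H ≤ A
  · exact (hA.eq_of_le_cdMeasure_of_le hcard hZ hH hHA).imp_right Or.inl
  by_cases hKA : centralizer (H : Set P) ≤ A
  · rcases hA.eq_of_le_cdMeasure_of_le hcard hZ (hH.trans (cdMeasure_le_centralizer H)) hKA
      with h | h
    · right; right
      rw [cdMeasure, h, hZ] at hH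
      refine eq_top_of_card_eq _ (le_antisymm (card_le_card_group _) ?_)
      rw [hcard]
      exact Nat.le_of_mul_le_mul_right (hH.trans_eq' (by ring)) (pow_pos hp.out.pos 2)
    · refine absurd ?_ hHA
      by_cases hAZ : A ≤ center P
      · have := card_le_of_le hAZ
        rw [hZ, hA.2.2.1] at this
        exact absurd ((Nat.pow_le_pow_iff_right hp.out.one_lt).1 this) (by norm_num)
      · have := le_centralizer_iff.1 (le_refl (centralizer (H : Set P)))
        rwa [h, hA.centralizer_eq hcard hZ le_rfl hAZ] at this
  -- Now each of H and C(H) is centralized by an element outside A, so each meets A inside Z(P).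
  exfalso
  have key : ∀ H K : Subgroup P, K ≤ centralizer (H : Set P) → ¬ K ≤ A → H ⊓ A ≤ center P := by
    intro H K hK hKA h hh
    obtain ⟨k, hk, hkA⟩ := SetLike.not_le_iff_exists.1 hKA
    rw [← hA.inf_centralizer hcard hZ hkA]
    exact ⟨hh.2, mem_centralizer_singleton_iff.2 (mem_centralizer_iff.1 (hK hk) h hh.1)⟩
  obtain ⟨h1, h2⟩ := hA.card_le_of_inf_le hcard hZ (key H _ le_rfl hKA)
  obtain ⟨h3, h4⟩ := hA.card_le_of_inf_le hcard hZ (key _ H (le_centralizer_iff.1 le_rfl) hHA)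
  have hpos : 0 < p ^ 4 := pow_pos hp.out.pos 4
  rw [cdMeasure, show p ^ 8 = p ^ 4 * p ^ 4 by ring] at hH
  refine hder (hA.commutator_mem_center_of_sup (h2 ?_) (h4 ?_))
  · exact Nat.le_of_mul_le_mul_right (hH.trans (Nat.mul_le_mul_left _ h3)) hpos
  · exact Nat.le_of_mul_le_mul_left (hH.trans (Nat.mul_le_mul_right _ h1)) hpos

theorem IsMiddleSubgroup.CD_eq {A : Subgroup P} (hA : IsMiddleSubgroup p A)
    (hcard : Nat.card P = p ^ 6) (hZ : Nat.card (center P) = p ^ 2)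
    (hder : ¬ commutator P ≤ center P) : CD P = {center P, A, ⊤} := by
  have hAZ : ¬ A ≤ center P := fun h => by
    have := card_le_of_le h
    rw [hZ, hA.2.2.1] at this
    exact absurd ((Nat.pow_le_pow_iff_right hp.out.one_lt).1 this) (by norm_num)
  have hm : ∀ H ∈ ({center P, A, ⊤} : Set (Subgroup P)), cdMeasure H = p ^ 8 := by
    rintro H (rfl | rfl | rfl)
    · rw [cdMeasure, centralizer_center, card_top, hZ, hcard]; ring
    · rw [cdMeasure, hA.centralizer_eq hcard hZ le_rfl hAZ, hA.2.2.1]; ring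
    · rw [cdMeasure, coe_top, centralizer_univ, card_top, hZ, hcard]; ring
  ext H
  constructor
  · intro hH
    refine hA.eq_of_le_cdMeasure hcard hZ hder ?_
    rw [← hm (center P) (Or.inl rfl)]
    exact hH _
  · intro hH K
    rw [hm H hH]
    by_contra! hlt
    exact hlt.ne' (hm K (hA.eq_of_le_cdMeasure hcard hZ hder hlt.le))

theorem IsMiddleSubgroup.isChainOfLength {A : Subgroup P} (hA : IsMiddleSubgroup p A)
    (hcard : Nat.card P = p ^ 6) (hZ : Nat.card (center P) = p ^ 2)
    (hder : ¬ commutator P ≤ center P) : IsChainOfLength (CD P) 2 := by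
  refine ⟨![center P, A, ⊤], ?_, ?_⟩
  · rw [Fin.strictMono_iff_lt_succ]
    intro i
    fin_cases i
    · refine lt_of_le_of_ne (hA.center_le hcard) fun h => ?_
      change center P = A at h
      have := hA.2.2.1
      rw [← h, hZ] at this
      exact absurd (Nat.pow_right_injective hp.out.one_lt this) (by norm_num)
    · obtain ⟨x, hx⟩ := hA.exists_notMem hcard
      exact lt_top_iff_ne_top.2 fun h => hx (by
        change A = ⊤ at h
        rw [h]; exact mem_top x)
  · rw [hA.CD_eq hcard hZ hder]
    simp [Matrix.range_cons]
    aesop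

end Middle

/-! ### Structure of P forced by the chain Z(P) < A < P -/

/-- `A` is a self-centralizing normal subgroup of order `p ^ 4` of a group `P` of order `p ^ 6`
with centre of order `p ^ 2`, and the only subgroups of measure at least `p ^ 8` are `Z(P)`,
`A` and `P`. -/
structure IsChainMiddle (p : ℕ) {P : Type*} [Group P] (A : Subgroup P) : Prop where
  card_eq : Nat.card P = p ^ 6
  card_center : Nat.card (center P) = p ^ 2
  card_middle : Nat.card A = p ^ 4
  normal : A.Normal
  centralizer_eq : centralizer (A : Set P) = A
  eq_of_le : ∀ H : Subgroup P, p ^ 8 ≤ cdMeasure H → H = center P ∨ H = A ∨ H = ⊤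

namespace IsChainMiddle

set_option linter.unusedSectionVars false

variable {p : ℕ} [hp : Fact p.Prime] {P : Type*} [Group P] [Finite P] {A : Subgroup P}

theorem isPGroup (h : IsChainMiddle p A) : IsPGroup p P := IsPGroup.of_card h.card_eq

theorem center_le (h : IsChainMiddle p A) : center P ≤ A := by
  rw [← h.centralizer_eq]
  exact center_le_centralizer _

theorem comm (h : IsChainMiddle p A) {a b : P} (ha : a ∈ A) (hb : b ∈ A) : a * b = b * a := by
  rw [← h.centralizer_eq] at hb
  exact mem_centralizer_iff.1 hb a ha

/-- Otherwise Z(P)⟨z⟩ has measure at least p³p⁵, yet it is none of the three permitted subgroups. -/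
theorem card_centralizer_le (h : IsChainMiddle p A) {z : P} (hz : z ∉ center P) :
    Nat.card (centralizer {z} : Subgroup P) ≤ p ^ 4 := by
  by_contra! hlt
  have h5 : p ^ 5 ≤ Nat.card (centralizer {z} : Subgroup P) := by
    obtain ⟨n, hn⟩ := IsPGroup.iff_card.1 (h.isPGroup.to_subgroup (centralizer {z}))
    rw [hn] at hlt ⊢
    exact Nat.pow_le_pow_right hp.out.pos ((Nat.pow_lt_pow_iff_right hp.out.one_lt).1 hlt)
  have h3 := h.isPGroup.mul_card_le_of_lt (lt_sup_zpowers hz)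
  have hC : centralizer ((center P ⊔ zpowers z : Subgroup P) : Set P) = centralizer {z} := by
    rw [centralizer_sup_zpowers, centralizer_center, top_inf_eq]
  have hm : p ^ 8 ≤ cdMeasure (center P ⊔ zpowers z) := by
    rw [cdMeasure, hC]
    rw [h.card_center] at h3
    calc p ^ 8 = p * p ^ 2 * p ^ 5 := by ring
      _ ≤ _ := Nat.mul_le_mul h3 h5
  rcases h.eq_of_le _ hm with h' | h' | h'
  · exact (lt_sup_zpowers hz).ne' h'
  · rw [h', h.centralizer_eq] at hC
    rw [← hC, h.card_middle] at hlt
    exact hlt.false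
  · rw [h', coe_top, centralizer_univ] at hC
    rw [← hC, h.card_center] at hlt
    exact absurd ((Nat.pow_lt_pow_iff_right hp.out.one_lt).1 hlt) (by norm_num)

theorem inf_centralizer (h : IsChainMiddle p A) {x : P} (hx : x ∉ A) :
    A ⊓ centralizer {x} = center P := by
  refine le_antisymm (fun y hy => ?_) (le_inf h.center_le (center_le_centralizer _))
  by_contra hyc
  have hle : A ≤ centralizer {y} := fun a ha =>
    mem_centralizer_singleton_iff.2 (h.comm ha hy.1)
  have := h.card_centralizer_le hyc
  rw [← h.card_middle] at this
  have heq := eq_of_le_of_card_ge hle this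
  refine hx ?_
  rw [heq]
  exact mem_centralizer_singleton_iff.2 (mem_centralizer_singleton_iff.1 hy.2).symm

theorem commutator_le (h : IsChainMiddle p A) (x y : P) : ⁅x, y⁆ ∈ A := by
  have := h.normal
  rw [← QuotientGroup.mk_mul_comm_iff]
  refine (IsPGroup.isMulCommutative_of_card_eq_prime_sq (p := p) ?_).is_comm.comm _ _
  have h1 := card_eq_card_quotient_mul_card_subgroup A
  rw [h.card_eq, h.card_middle] at h1
  exact Nat.eq_of_mul_eq_mul_right (pow_pos hp.out.pos 4) (h1.symm.trans (by ring))

theorem card_quotient (h : IsChainMiddle p A) : Nat.card (P ⧸ center P) = p ^ 4 := by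
  have h1 := card_eq_card_quotient_mul_card_subgroup (center P)
  rw [h.card_eq, h.card_center] at h1
  exact Nat.eq_of_mul_eq_mul_right (pow_pos hp.out.pos 2) (h1.symm.trans (by ring))

theorem card_map (h : IsChainMiddle p A) :
    Nat.card (A.map (QuotientGroup.mk' (center P))) = p ^ 2 := by
  have h1 := card_map_mk'_mul_card (center P) A h.center_le
  rw [h.card_middle, h.card_center] at h1
  exact Nat.eq_of_mul_eq_mul_right (pow_pos hp.out.pos 2) (h1.trans (by ring))

theorem mk_mem_map (h : IsChainMiddle p A) {x : P} :
    (x : P ⧸ center P) ∈ A.map (QuotientGroup.mk' (center P)) ↔ x ∈ A := by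
  rw [← QuotientGroup.mk'_apply, ← mem_comap, comap_map_eq_self]
  rw [QuotientGroup.ker_mk']
  exact h.center_le

/-- Some m outside A centralizes A modulo Z(P). As P/A is abelian, m commutes with ⁅g, a⁆, which
thus lies in C_A(m) = Z(P). -/
theorem commutator_mem_center (h : IsChainMiddle p A) {a : P} (ha : a ∈ A) (g : P) :
    ⁅g, a⁆ ∈ center P := by
  have := h.normal
  have hnorm : (A.map (QuotientGroup.mk' (center P))).Normal :=
    Normal.map inferInstance _ (QuotientGroup.mk'_surjective _)
  obtain ⟨m, hmA, hm⟩ := (h.isPGroup.to_quotient (center P)).exists_notMem_centralizing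
    h.card_quotient _ h.card_map
  obtain ⟨m, rfl⟩ := QuotientGroup.mk_surjective m
  rw [h.mk_mem_map] at hmA
  have hmc : ⁅m, a⁆ ∈ center P :=
    (QuotientGroup.mk_mul_comm_iff _ _ _).1 (hm a ⟨a, ha, rfl⟩)
  rw [← h.inf_centralizer hmA]
  refine ⟨h.commutator_le g a, mem_centralizer_singleton_iff.2 ?_⟩
  -- conjugation by `m` multiplies both `a` and its conjugate under `g` by the same central element
  have e1 : m * a * m⁻¹ = ⁅m, a⁆ * a := by rw [commutatorElement_def]; group
  have hw := mem_center_iff.1 hmc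
  have e2 : m * (g * a * g⁻¹) * m⁻¹ = ⁅m, a⁆ * (g * a * g⁻¹) := by
    have hk : ⁅m⁻¹, g⁻¹⁆ * a = a * ⁅m⁻¹, g⁻¹⁆ := h.comm (h.commutator_le _ _) ha
    calc m * (g * a * g⁻¹) * m⁻¹
        = g * m * (⁅m⁻¹, g⁻¹⁆ * a) * ⁅m⁻¹, g⁻¹⁆⁻¹ * m⁻¹ * g⁻¹ := by
          rw [commutatorElement_def]; group
      _ = g * (m * a * m⁻¹) * g⁻¹ := by rw [hk]; group
      _ = (g * ⁅m, a⁆) * a * g⁻¹ := by rw [e1]; simp only [mul_assoc]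
      _ = _ := by rw [hw g]; simp only [mul_assoc]
  calc ⁅g, a⁆ * m = ⁅m, a⁆ * ((g * a * g⁻¹ * a⁻¹) * ⁅m, a⁆⁻¹) * m := by
        rw [(mem_center_iff.1 (inv_mem hmc) _), commutatorElement_def g a]; group
    _ = (⁅m, a⁆ * (g * a * g⁻¹)) * (⁅m, a⁆ * a)⁻¹ * m := by
        rw [mul_inv_rev]; simp only [mul_assoc]
    _ = m * ⁅g, a⁆ := by
        rw [← e1, ← e2, commutatorElement_def g a]; group

theorem commutatorWith_eq (h : IsChainMiddle p A) {x : P} (hx : x ∉ A) :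
    commutatorWith A x = center P := by
  have hle : commutatorWith A x ≤ center P := by
    rw [commutatorWith, closure_le]
    rintro _ ⟨a, ha, rfl⟩
    have := inv_mem (h.commutator_mem_center (inv_mem ha) x⁻¹)
    rw [commutatorElement_inv, commutatorElement_def, inv_inv, inv_inv] at this
    exact this
  have hcard := card_commutatorWith_mul_card A x fun a ha b _ =>
    (mem_center_iff.1 (hle (mem_commutatorWith_of_mem ha x)) b).symm
  rw [h.inf_centralizer hx, h.card_center, h.card_middle] at hcard
  refine eq_of_le_of_card_ge hle ?_
  rw [h.card_center]
  exact (Nat.eq_of_mul_eq_mul_right (pow_pos hp.out.pos 2) (hcard.trans (by ring))).ge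

theorem isMiddleSubgroup (h : IsChainMiddle p A) : IsMiddleSubgroup p A :=
  ⟨h.normal, le_centralizer_iff_isMulCommutative.1 h.centralizer_eq.ge, h.card_middle,
    fun _ hx => h.commutatorWith_eq hx⟩

/-- If P' were central, y outside A would have at most p² conjugates, so |C(y)| = p^4. Then C(y) is
abelian, since Z(P)⟨y⟩ is central in it of index at most p, and so it has measure at least p^8. -/
theorem not_commutator_le (h : IsChainMiddle p A) : ¬ commutator P ≤ center P := by
  intro hle
  obtain ⟨y, hy⟩ := h.isMiddleSubgroup.exists_notMem h.card_eq
  have hyc : y ∉ center P := fun hc => hy (h.center_le hc)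
  have h1 := (⊤ : Subgroup P).card_le_card_mul_card_inf_centralizer (center P) y
    fun g _ => hle (commutator_mem_commutator (mem_top g) (mem_top y))
  rw [top_inf_eq, card_top, h.card_eq, h.card_center] at h1
  have h2 : Nat.card (centralizer {y} : Subgroup P) = p ^ 4 :=
    le_antisymm (h.card_centralizer_le hyc)
      (Nat.le_of_mul_le_mul_left (h1.trans_eq' (by ring)) (pow_pos hp.out.pos 2))
  set B : Subgroup P := centralizer {y} with hB
  have hKB : center P ⊔ zpowers y ≤ B := sup_le (center_le_centralizer _)
    (by rw [zpowers_le, hB, mem_centralizer_singleton_iff])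
  have h3 := h.isPGroup.mul_card_le_of_lt (lt_sup_zpowers hyc)
  have hcomm := (h.isPGroup.to_subgroup B).mul_comm_of_card_le
    ((center P ⊔ zpowers y).subgroupOf B) (fun k hk => mem_center_iff.2 fun b => by
      have hb : (b : P) ∈ centralizer ((center P ⊔ zpowers y : Subgroup P) : Set P) := by
        rw [centralizer_sup_zpowers, centralizer_center, top_inf_eq]
        exact b.2
      exact Subtype.ext (mem_centralizer_iff.1 hb k hk).symm) (by
      rw [Nat.card_congr (subgroupOfEquivOfLe hKB).toEquiv, h2]
      rw [h.card_center] at h3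
      calc p ^ 4 = p * (p * p ^ 2) := by ring
        _ ≤ _ := Nat.mul_le_mul_left _ h3)
  have hBB : B ≤ centralizer (B : Set P) := fun b hb => mem_centralizer_iff.2 fun c hc =>
    congrArg Subtype.val (hcomm ⟨c, hc⟩ ⟨b, hb⟩)
  have hm : p ^ 8 ≤ cdMeasure B := by
    rw [cdMeasure]
    calc p ^ 8 = p ^ 4 * p ^ 4 := by ring
      _ ≤ _ := Nat.mul_le_mul h2.ge (h2.ge.trans (card_le_of_le hBB))
  have hyB : y ∈ B := hKB ((le_sup_right : zpowers y ≤ _) (mem_zpowers y))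
  rcases h.eq_of_le B hm with h' | h' | h'
  · exact hyc (h' ▸ hyB)
  · exact hy (h' ▸ hyB)
  · rw [h', card_top, h.card_eq] at h2
    exact absurd (Nat.pow_right_injective hp.out.one_lt h2) (by norm_num)

theorem map_le_center (h : IsChainMiddle p A) :
    A.map (QuotientGroup.mk' (center P)) ≤ center (P ⧸ center P) := by
  rintro _ ⟨a, ha, rfl⟩
  refine mem_center_iff.2 fun q => ?_
  obtain ⟨q, rfl⟩ := QuotientGroup.mk_surjective q
  exact (QuotientGroup.mk_mul_comm_iff _ q a).2 (h.commutator_mem_center ha q)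

/-- Z(P) = [A, x] lies properly in P', and (P/Z(P))' has order at most p because A/Z(P) is central
of index p². -/
theorem card_commutator (h : IsChainMiddle p A) : Nat.card (commutator P) = p ^ 3 := by
  have hle : center P ≤ commutator P := by
    obtain ⟨x, hx⟩ := h.isMiddleSubgroup.exists_notMem h.card_eq
    rw [← h.commutatorWith_eq hx, commutatorWith, closure_le]
    rintro _ ⟨a, -, rfl⟩
    have := commutator_mem_commutator (mem_top a⁻¹) (mem_top x⁻¹)
    rwa [commutatorElement_def, inv_inv, inv_inv] at this
  have h1 := h.isPGroup.mul_card_le_of_lt (lt_of_le_not_ge hle h.not_commutator_le)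
  have h2 := (h.isPGroup.to_quotient (center P)).card_commutator_le _ h.map_le_center
    (by rw [h.card_map, h.card_quotient]; ring)
  have h3 := card_map_mk'_mul_card (center P) (commutator P) hle
  have h4 : (commutator P).map (QuotientGroup.mk' (center P)) = commutator (P ⧸ center P) := by
    rw [_root_.commutator_def, map_commutator, _root_.commutator_def,
      map_top_of_surjective _ (QuotientGroup.mk'_surjective _)]
  rw [h4, h.card_center] at h3
  rw [h.card_center] at h1
  refine le_antisymm ?_ (h1.trans_eq' (by ring))
  rw [← h3, pow_succ' p 2]
  exact Nat.mul_le_mul_right _ h2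

/-- If x is outside A and x² is in A, then x² ∈ C_A(x) = Z(P). For p = 2 this makes P/Z(P) abelian.
-/
theorem ne_two (h : IsChainMiddle p A) : p ≠ 2 := by
  rintro rfl
  refine h.not_commutator_le ?_
  rw [_root_.commutator_def, Subgroup.commutator_le]
  intro x _ y _
  rw [← QuotientGroup.mk_mul_comm_iff]
  refine IsPGroup.comm_of_index_eq_four _ h.map_le_center
    (by rw [h.card_map, h.card_quotient]; norm_num) (fun q hq hq2 => ?_) _ _
  obtain ⟨q, rfl⟩ := QuotientGroup.mk_surjective q
  rw [h.mk_mem_map] at hq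
  rw [← QuotientGroup.mk_pow, h.mk_mem_map] at hq2
  rw [← QuotientGroup.mk_pow, QuotientGroup.eq_one_iff, ← h.inf_centralizer hq]
  exact ⟨hq2, mem_centralizer_singleton_iff.2 (by rw [sq, mul_assoc])⟩

end IsChainMiddle

/-! ### From a chain of length two to the orders p², p⁴, p⁶ -/

theorem centralizer_lt_of_mem_CD {G : Type*} [Group G] [Finite G] {H K : Subgroup G}
    (hH : H ∈ CD G) (hK : K ∈ CD G) (h : H < K) :
    centralizer (K : Set G) < centralizer (H : Set G) := by
  refine lt_of_le_of_ne (centralizer_le h.le) fun heq => h.ne ?_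
  rw [← centralizer_centralizer_of_mem_CD hH, ← heq, centralizer_centralizer_of_mem_CD hK]

/-- Taking centralizers reverses a Chermak-Delgado lattice that is a chain of length two. -/
theorem IsChainOfLength.exists_terms {G : Type*} [Group G] [Finite G]
    (h : IsChainOfLength (CD G) 2) : ∃ H K L : Subgroup G, H < K ∧ K < L ∧ CD G = {H, K, L} ∧
      centralizer (H : Set G) = L ∧ centralizer (K : Set G) = K ∧
      centralizer (L : Set G) = H := by
  obtain ⟨f, hf, hr⟩ := h
  have h01 : f 0 < f 1 := hf (by decide)
  have h12 : f 1 < f 2 := hf (by decide)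
  have hmem : ∀ i, f i ∈ CD G := fun i => hr ▸ Set.mem_range_self i
  have hCD : CD G = {f 0, f 1, f 2} := by
    rw [← hr]
    ext K
    simp [Fin.exists_fin_succ, eq_comm]
  refine ⟨f 0, f 1, f 2, h01, h12, hCD, ?_⟩
  have hc0 := centralizer_mem_CD (hmem 0)
  have hc1 := centralizer_mem_CD (hmem 1)
  have hc2 := centralizer_mem_CD (hmem 2)
  have hlt01 := centralizer_lt_of_mem_CD (hmem 0) (hmem 1) h01
  have hlt12 := centralizer_lt_of_mem_CD (hmem 1) (hmem 2) h12
  rw [hCD] at hc0 hc1 hc2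
  -- Of the 27 assignments of centralizers, only the reversal is strictly decreasing.
  rcases hc0 with h0 | h0 | h0 <;> rcases hc1 with h1 | h1 | h1 <;>
    rcases hc2 with h2 | h2 | h2 <;> rw [h0, h1] at hlt01 <;> rw [h1, h2] at hlt12 <;>
    first | exact ⟨h0, h1, h2⟩ | (exfalso; order)

section Chain

set_option linter.unusedSectionVars false

variable {p : ℕ} [hp : Fact p.Prime] {P : Type*} [Group P] [Finite P] {H K L : Subgroup P}

theorem card_eq_of_CD_eq (hHK : H < K) (hKL : K < L) (hCD : CD P = {H, K, L}) :
    ∀ M ∈ CD P, ∀ N ∈ CD P, Nat.card M = Nat.card N → M = N := by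
  have hlt : ∀ {M N : Subgroup P}, M < N → Nat.card M ≠ Nat.card N := fun h hc =>
    h.ne (eq_of_le_of_card_ge h.le hc.ge)
  have h1 := hlt hHK
  have h2 := hlt hKL
  have h3 := hlt (hHK.trans hKL)
  rw [hCD]
  rintro M (rfl | rfl | rfl) N (rfl | rfl | rfl) h <;> first | rfl | exact absurd h ‹_› |
    exact absurd h.symm ‹_›

/-- A member of the lattice that is not `H` is self-centralizing only if it is `K`. -/
theorem eq_of_mem_CD_of_le_centralizer (hHK : H < K) (hKL : K < L) (hCD : CD P = {H, K, L})
    (hL : centralizer (L : Set P) = H) {M : Subgroup P} (hM : M ∈ CD P) (hne : M ≠ H)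
    (hMM : M ≤ centralizer (M : Set P)) : M = K := by
  rw [hCD] at hM
  rcases hM with rfl | rfl | rfl
  · exact absurd rfl hne
  · rfl
  · rw [hL] at hMM
    exact absurd (hHK.trans hKL) hMM.not_gt

/-- If |K| = p|H|, then for x in L outside K the abelian group H⟨x⟩ has order at least |K|, so it
belongs to the lattice and must be K, although x ∉ K. -/
theorem mul_card_lt_of_CD_eq (hP : IsPGroup p P) (hHK : H < K) (hKL : K < L)
    (hCD : CD P = {H, K, L}) (hK : centralizer (K : Set P) = K)
    (hL : centralizer (L : Set P) = H) : p * Nat.card H < Nat.card K := by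
  refine lt_of_le_of_ne (hP.mul_card_le_of_lt hHK) fun heq => ?_
  obtain ⟨x, hxL, hxK⟩ := SetLike.exists_of_lt hKL
  have hxH : x ∉ H := fun h => hxK (hHK.le h)
  have hxc : x ∈ centralizer (H : Set P) := by
    rw [← hL]; exact le_centralizer_iff.1 le_rfl hxL
  have hHH : H ≤ centralizer (H : Set P) :=
    hHK.le.trans (hK.ge.trans (centralizer_le hHK.le))
  have hMM := isMulCommutative_sup_zpowers H hHH hxc
  have hcard := hP.mul_card_le_of_lt (lt_sup_zpowers hxH)
  rw [heq] at hcard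
  have hM : H ⊔ zpowers x ∈ CD P := fun N => by
    have hKmem : K ∈ CD P := by rw [hCD]; exact Or.inr (Or.inl rfl)
    refine (hKmem N).trans ?_
    rw [cdMeasure, cdMeasure, hK]
    exact Nat.mul_le_mul hcard (hcard.trans (card_le_of_le hMM))
  have := eq_of_mem_CD_of_le_centralizer hHK hKL hCD hL hM (lt_sup_zpowers hxH).ne' hMM
  exact hxK (this ▸ (le_sup_right : zpowers x ≤ _) (mem_zpowers x))

/-- Take z in K outside H and central modulo H. Then |C_L(z)| ≥ p^4, so H⟨z⟩ attains the measure p^6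
and must be K, whose centralizer has order only p^3. -/
theorem card_ne_prime_of_CD_eq (hP : IsPGroup p P) (hHK : H < K) (hKL : K < L)
    (hCD : CD P = {H, K, L}) (hH : centralizer (H : Set P) = L)
    (hK : centralizer (K : Set P) = K) (hL : centralizer (L : Set P) = H) :
    ¬ (Nat.card H = p ∧ Nat.card K = p ^ 3 ∧ Nat.card L = p ^ 5) := by
  rintro ⟨h1, h3, h5⟩
  have huniq := card_eq_of_CD_eq hHK hKL hCD
  have hHmem : H ∈ CD P := by rw [hCD]; exact Or.inl rfl
  have hKmem : K ∈ CD P := by rw [hCD]; exact Or.inr (Or.inl rfl)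
  have := normal_of_mem_CD_of_card hHmem fun N hN hc => huniq N hN H hHmem hc
  have := normal_of_mem_CD_of_card hKmem fun N hN hc => huniq N hN K hKmem hc
  obtain ⟨z, hzK, hzH, hz⟩ := hP.exists_mem_notMem_commutator_mem hHK
  have hC := L.card_le_card_mul_card_inf_centralizer H z fun g _ => hz g
  rw [h1, h5] at hC
  have hC4 : p ^ 4 ≤ Nat.card (L ⊓ centralizer {z} : Subgroup P) :=
    Nat.le_of_mul_le_mul_left (hC.trans_eq' (by ring)) hp.out.pos
  have hcard := hP.mul_card_le_of_lt (lt_sup_zpowers hzH)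
  rw [h1] at hcard
  have hHK' : H ≤ centralizer (K : Set P) := hHK.le.trans hK.ge
  have hzc : z ∈ centralizer (H : Set P) := by
    rw [hH]; exact hKL.le hzK
  have hMM := isMulCommutative_sup_zpowers H (hHK'.trans (centralizer_le hHK.le)) hzc
  have hM : H ⊔ zpowers z ∈ CD P := fun N => by
    refine (hKmem N).trans ?_
    rw [cdMeasure, cdMeasure, hK, h3, centralizer_sup_zpowers, hH]
    calc p ^ 3 * p ^ 3 = p * p * p ^ 4 := by ring
      _ ≤ _ := Nat.mul_le_mul hcard hC4
  have heq := eq_of_mem_CD_of_le_centralizer hHK hKL hCD hL hM (lt_sup_zpowers hzH).ne' hMM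
  have hc := centralizer_sup_zpowers H z
  rw [heq, hK, hH] at hc
  rw [← hc, h3] at hC4
  exact absurd ((Nat.pow_le_pow_iff_right hp.out.one_lt).1 hC4) (by norm_num)

theorem isChainMiddle_of_CD_eq (hP : IsPGroup p P) (hcard : Nat.card P ≤ p ^ 6)
    (hHK : H < K) (hKL : K < L) (hCD : CD P = {H, K, L}) (hH : centralizer (H : Set P) = L)
    (hK : centralizer (K : Set P) = K) (hL : centralizer (L : Set P) = H) :
    IsChainMiddle p K := by
  have h1 := hp.out.one_lt
  have hHmem : H ∈ CD P := by rw [hCD]; exact Or.inl rfl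
  have hKmem : K ∈ CD P := by rw [hCD]; exact Or.inr (Or.inl rfl)
  obtain ⟨a, ha⟩ := IsPGroup.iff_card.1 (hP.to_subgroup H)
  obtain ⟨b, hb⟩ := IsPGroup.iff_card.1 (hP.to_subgroup K)
  obtain ⟨c, hc⟩ := IsPGroup.iff_card.1 (hP.to_subgroup L)
  have hm : a + c = b + b := by
    have := le_antisymm (hKmem H) (hHmem K)
    rw [cdMeasure, cdMeasure, hH, hK, ha, hb, hc, ← pow_add, ← pow_add] at this
    exact Nat.pow_right_injective h1 this
  have hab : a + 1 < b := by
    have := mul_card_lt_of_CD_eq hP hHK hKL hCD hK hL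
    rw [ha, hb, ← pow_succ'] at this
    exact (Nat.pow_lt_pow_iff_right h1).1 this
  have hc6 : c ≤ 6 := by
    have := (card_le_card_group L).trans hcard
    rw [hc] at this
    exact (Nat.pow_le_pow_iff_right h1).1 this
  have hnt : Nontrivial P := by
    obtain ⟨x, -, hx⟩ := SetLike.exists_of_lt hHK
    exact ⟨x, 1, fun h => hx (h ▸ one_mem H)⟩
  have ha0 : a ≠ 0 := by
    rintro rfl
    have hbot : H = ⊥ := card_eq_one.1 (by rw [ha, pow_zero])
    have : center P ≤ H := by rw [← hL]; exact center_le_centralizer _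
    rw [hbot] at this
    exact hP.bot_lt_center.not_ge this
  have ha1 : a ≠ 1 := by
    rintro rfl
    refine card_ne_prime_of_CD_eq hP hHK hKL hCD hH hK hL ⟨by rw [ha, pow_one], ?_, ?_⟩
    · rw [hb]; congr; omega
    · rw [hc]; congr; omega
  -- The constraints are a ≥ 2, b ≥ a + 2, a + c = 2b and c ≤ 6.
  obtain rfl : a = 2 := by omega
  obtain rfl : b = 4 := by omega
  obtain rfl : c = 6 := by omega
  have hP6 : Nat.card P = p ^ 6 := le_antisymm hcard (hc ▸ card_le_card_group L)
  have hLtop : L = ⊤ := eq_top_of_card_eq _ (hc.trans hP6.symm)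
  have hHZ : H = center P := by rw [← hL, hLtop, coe_top, centralizer_univ]
  refine ⟨hP6, hHZ ▸ ha, hb, ?_, hK, fun M hM => ?_⟩
  · exact normal_of_mem_CD_of_card hKmem fun N hN hc =>
      card_eq_of_CD_eq hHK hKL hCD N hN K hKmem hc
  · have hMmem : M ∈ CD P := fun N => by
      refine (hKmem N).trans (hM.trans_eq' ?_)
      rw [cdMeasure, hK, hb]; ring
    rw [hCD, hHZ, hLtop] at hMmem
    exact hMmem

end Chain

theorem propositionl2 (p : ℕ) (hp : p.Prime) (P : Type*) [Group P] [Finite P]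
    (hP : IsPGroup p P) (hcard : Nat.card P ≤ p ^ 6) :
    (IsChainOfLength (CD P) 2 ↔
      p ≠ 2 ∧ Nat.card P = p ^ 6 ∧ Nat.card (Subgroup.center P) = p ^ 2 ∧
        Nat.card (commutator P) = p ^ 3 ∧ ∃ A : Subgroup P, IsMiddleSubgroup p A) ∧
    (IsChainOfLength (CD P) 2 →
      ∀ A : Subgroup P, IsMiddleSubgroup p A → CD P = {Subgroup.center P, A, ⊤}) := by
  have : Fact p.Prime := ⟨hp⟩
  have hmiddle : IsChainOfLength (CD P) 2 → ∃ A : Subgroup P, IsChainMiddle p A := fun h => by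
    obtain ⟨H, K, L, hHK, hKL, hCD, hH, hK, hL⟩ := h.exists_terms
    exact ⟨K, isChainMiddle_of_CD_eq hP hcard hHK hKL hCD hH hK hL⟩
  refine ⟨⟨fun h => ?_, ?_⟩, fun h A hA => ?_⟩
  · obtain ⟨A, hA⟩ := hmiddle h
    exact ⟨hA.ne_two, hA.card_eq, hA.card_center, hA.card_commutator, A, hA.isMiddleSubgroup⟩
  · rintro ⟨-, h6, hZ, hder, A, hA⟩
    refine hA.isChainOfLength h6 hZ fun hle => ?_
    have := Subgroup.card_le_of_le hle
    rw [hZ, hder] at this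
    exact absurd ((Nat.pow_le_pow_iff_right hp.one_lt).1 this) (by norm_num)
  -- The middle term B of the chain supplies the facts about P; A itself may be any middle subgroup.
  · obtain ⟨B, hB⟩ := hmiddle h
    exact hA.CD_eq hB.card_eq hB.card_center hB.not_commutator_le
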